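/- Let $\mathbb{D}$ be the open unit disc. The space $H^\infty_2$ consists of the analytic functions $A$ in $\mathbb{D}$ with $\sup_{z\in\mathbb{D}}|A(z)|(1-|z|^2)^2<\infty$, and the Bloch space $\mathcal{B}$ of the analytic functions $g$ in $\mathbb{D}$ with $\sup_{z\in\mathbb{D}}|g'(z)|(1-|z|^2)<\infty$. A (finite or infinite, possibly empty) sequence $\Lambda=\{z_n\}$ of points of $\mathbb{D}$ is called uniformly separated if there is $0<\delta<1$ such that $|z_n-z_k|/|1-\overline{z_n}z_k|>\delta$ for all $n\neq k$, and the measure $\mu=\sum_n(1-|z_n|)\delta_{z_n}$ (where $\delta_{z_n}$ is the Dirac measure at $z_n$) is a Carleson measure, that is, for some (equivalently, every) $0<p<\infty$ there is a constant $C>0$ such that $\int_{\mathbb{D}}|f|^p\,d\mu\leq C\|f\|_{H^p}^p$ for all $f$ in the Hardy space $H^p$. Zero-sequences list zeros in $\mathbb{D}$ with multiplicity. A Blaschke product is a unimodular constant times a finite or infinite product of the usual Blaschke factors. (i) If $A\in H^\infty_2$ and $f$ is a solution of $f''+Af=0$ in $\mathbb{D}$, $f\not\equiv 0$, whose zero-sequence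 $\Lambda$ is uniformly separated, then $f$ can be factorized as $f=Be^g$, where $B$ is a Blaschke product whose zero-sequence is $\Lambda$ and where $g\in\mathcal{B}$ satisfies the interpolation property $$g'(z_n)=-\frac12\,\frac{B''(z_n)}{B'(z_n)},\qquad z_n\in\Lambda.$$ (ii) Conversely, if $B$ is any Blaschke product whose zero-sequence $\Lambda$ is uniformly separated and $g\in\mathcal{B}$ satisfies this interpolation property, then $f=Be^g$ is a solution of $f''+Af=0$ in $\mathbb{D}$ for some $A\in H^\infty_2$. -/

import Mathlib

open Set Filter Topology MeasureTheory
open scoped ENNReal NNReal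

namespace DiscODE

/-- The open unit disc of the complex plane.  Functions on the disc are modelled as functions
`ℂ → ℂ` of which only the restriction to the disc matters. -/
def unitDisc : Set ℂ := Metric.ball 0 1

/-- `f` is analytic in the unit disc. -/
def IsAnalyticInDisc (f : ℂ → ℂ) : Prop := DifferentiableOn ℂ f unitDisc

/-- The growth space `H^∞_α`: analytic functions `A` in the disc with
`sup |A(z)| (1 - |z|²)^α < ∞`. -/
def MemGrowthSpace (α : ℝ) (A : ℂ → ℂ) : Prop :=
  IsAnalyticInDisc A ∧ ∃ C : ℝ, ∀ z ∈ unitDisc, ‖A z‖ * (1 - ‖z‖ ^ 2) ^ α ≤ C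

/-- The Bloch space: analytic functions `g` in the disc with `sup |g'(z)| (1 - |z|²) < ∞`. -/
def MemBloch (g : ℂ → ℂ) : Prop :=
  IsAnalyticInDisc g ∧ ∃ C : ℝ, ∀ z ∈ unitDisc, ‖deriv g z‖ * (1 - ‖z‖ ^ 2) ≤ C

/-- The Hardy (quasi)norm
`lim_{r → 1⁻} ((1 / 2π) ∫_0^{2π} |f(r e^{iθ})|^p dθ)^{1/p}`, with values in `[0, ∞]`.
For analytic `f` the means increase with `r`, so that the limit exists and is the upper limit. -/
noncomputable def hardyNorm (p : ℝ) (f : ℂ → ℂ) : ℝ≥0∞ :=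
  limsup (fun r : ℝ =>
    (ENNReal.ofReal (1 / (2 * Real.pi)) *
      ∫⁻ θ in Ioc (0 : ℝ) (2 * Real.pi), ‖f (circleMap 0 r θ)‖ₑ ^ p) ^ (1 / p)) (𝓝[<] 1)

/-- The Hardy space `H^p`. -/
def MemHardy (p : ℝ) (f : ℂ → ℂ) : Prop := IsAnalyticInDisc f ∧ hardyNorm p f < ∞

/-- Carleson measures in the unit disc: `∫ |f|^p dμ ≤ C ‖f‖_{H^p}^p` for all `f ∈ H^p`.
The condition does not depend on the exponent `0 < p < ∞`; it is required for some exponent. -/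
def IsCarlesonMeasure (μ : Measure ℂ) : Prop :=
  ∃ p : ℝ, 0 < p ∧ ∃ C : ℝ≥0, ∀ f : ℂ → ℂ, MemHardy p f →
    ∫⁻ z in unitDisc, ‖f z‖ₑ ^ p ∂μ ≤ C * hardyNorm p f ^ p

/-- The pseudo-hyperbolic distance. -/
noncomputable def pseudoHyp (z w : ℂ) : ℝ := ‖z - w‖ / ‖1 - starRingEnd ℂ z * w‖

/-- A sequence (finite or infinite family) of points of the disc is separated in the hyperbolic
metric.  Distinct indices are compared, so repeated points are not allowed. -/
def IsSeparated {ι : Type*} (a : ι → ℂ) : Prop :=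
  ∃ δ : ℝ, 0 < δ ∧ δ < 1 ∧ ∀ i j, i ≠ j → δ < pseudoHyp (a i) (a j)

/-- A sequence of points of the disc is uniformly separated: it is separated and
`∑ (1 - |a_i|) δ_{a_i}` is a Carleson measure. -/
def UniformlySeparated {ι : Type*} (a : ι → ℂ) : Prop :=
  (∀ i, a i ∈ unitDisc) ∧ IsSeparated a ∧
    IsCarlesonMeasure (Measure.sum fun i => ENNReal.ofReal (1 - ‖a i‖) • Measure.dirac (a i))

/-- The sequence `a` lists the zeros of `f` in the disc, each as often as its multiplicity. -/
def IsZeroSequence {ι : Type*} (f : ℂ → ℂ) (a : ι → ℂ) : Prop :=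
  (∀ i, a i ∈ unitDisc) ∧ ∀ w ∈ unitDisc, analyticOrderAt f w = {i | a i = w}.encard

/-- The Blaschke factor with zero `a`, normalised to be `|a|` at the origin for `a ≠ 0`, and
equal to `z` for `a = 0`. -/
noncomputable def blaschkeFactor (a z : ℂ) : ℂ :=
  open Classical in
  if a = 0 then z else (‖a‖ / a) * ((a - z) / (1 - starRingEnd ℂ a * z))

/-- `B` is (in the disc) a Blaschke product with zero-sequence `a`: the sequence lies in the disc
and satisfies the Blaschke condition `∑ (1 - |a_i|) < ∞`, and `B` is a unimodular constant times
the convergent product of the Blaschke factors. -/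
def IsBlaschkeProduct {ι : Type*} (B : ℂ → ℂ) (a : ι → ℂ) : Prop :=
  (∀ i, a i ∈ unitDisc) ∧ Summable (fun i => 1 - ‖a i‖) ∧
    ∃ (c : ℂ) (P : ℂ → ℂ), ‖c‖ = 1 ∧
      ∀ z ∈ unitDisc, HasProd (fun i => blaschkeFactor (a i) z) (P z) ∧ B z = c * P z

/-- The interpolation property `g'(a_i) = -(1/2) B''(a_i) / B'(a_i)`. -/
def InterpolationProperty {ι : Type*} (B g : ℂ → ℂ) (a : ι → ℂ) : Prop :=
  ∀ i, deriv g (a i) = -(1 / 2) * (deriv (deriv B) (a i) / deriv B (a i))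

/-- `f` is a solution of `f'' + A f = 0` in the unit disc. -/
def IsSolution (A f : ℂ → ℂ) : Prop :=
  IsAnalyticInDisc f ∧ ∀ z ∈ unitDisc, deriv (deriv f) z + A z * f z = 0

end DiscODE

open DiscODE

namespace DiscODE

/-! Testing the Carleson condition on the powers `kernelPow` of the Cauchy kernel bounds the sums `∑
(1 - ρ(a_i, w)²)` uniformly in `w`, where `ρ` is the pseudo-hyperbolic distance. As `|B| = ∏ ρ(a_i,
·)`, this bounds `|B|` below off the discs `|z - a_i| < η (1 - |a_i|)`
(`IsBlaschkeProduct.exists_le_norm`). With separation, the zeros of `B` are exactly the `a_i`, all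
simple. For small `η` the discs are disjoint, so the maximum principle carries bounds from their
boundaries inside (`exists_norm_le_away`).

For `f = B e^g`, one has `f'' = (B'' + 2 B' g' + B (g'' + g'²)) e^g`. Hence `f'' + A f = 0` has an
analytic coefficient exactly when `B'' + 2 B' g'` vanishes at the zeros of `B`, which is the
interpolation property. In (ii), Cauchy estimates bound that numerator by a multiple of `(1 -
|z|)⁻²`, and the lower bound for `|B|` passes this on to its quotient by `B`.

In (i), `f / B` is analytic and zero-free, hence equal to `e^g`. To see that `g` is Bloch, put `N =
(1 - |z|) |g'(z)|`. Gronwall's inequality (`IsSolution.norm_le`) bounds `|f|` near `z` by a constant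
times `(3 + N) |e^{g(z)}|`. Dividing by `B` gives `Re g - Re g(z) ≤ log (K' (3 + N))` near `z`, and
Borel–Carathéodory then yields `N ≤ 16 log (K' (3 + N))`, which bounds `N`. -/

theorem mem_unitDisc {z : ℂ} : z ∈ unitDisc ↔ ‖z‖ < 1 := by
  simp [unitDisc]

theorem isOpen_unitDisc : IsOpen unitDisc := Metric.isOpen_ball

/-! ### Pseudo-hyperbolic distance and Blaschke factors -/

theorem one_sub_norm_le_norm_one_sub_conj_mul {z w : ℂ} (hz : ‖z‖ ≤ 1) :
    1 - ‖w‖ ≤ ‖1 - starRingEnd ℂ z * w‖ := by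
  have h := norm_sub_norm_le (1 : ℂ) (starRingEnd ℂ z * w)
  rw [norm_mul, RCLike.norm_conj, norm_one] at h
  nlinarith [norm_nonneg w]

theorem norm_one_sub_conj_mul_comm (z w : ℂ) :
    ‖1 - starRingEnd ℂ z * w‖ = ‖1 - starRingEnd ℂ w * z‖ := by
  rw [← RCLike.norm_conj]
  simp [mul_comm]

theorem norm_one_sub_conj_mul_pos {z w : ℂ} (hz : ‖z‖ ≤ 1) (hw : ‖w‖ < 1) :
    0 < ‖1 - starRingEnd ℂ z * w‖ :=
  (sub_pos.2 hw).trans_le (one_sub_norm_le_norm_one_sub_conj_mul hz)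

/-- The cross terms of `|1 - z̄w|²` and `|z - w|²` agree. This identity links the factors of `|B|²`
to integrals of the Cauchy kernel. -/
theorem one_sub_pseudoHyp_sq {z w : ℂ} (hz : ‖z‖ ≤ 1) (hw : ‖w‖ < 1) :
    1 - pseudoHyp z w ^ 2 =
      (1 - ‖z‖ ^ 2) * (1 - ‖w‖ ^ 2) / ‖1 - starRingEnd ℂ z * w‖ ^ 2 := by
  have h := norm_one_sub_conj_mul_pos hz hw
  rw [pseudoHyp, div_pow, eq_div_iff (by positivity), sub_mul,
    div_mul_cancel₀ _ (by positivity : ‖1 - starRingEnd ℂ z * w‖ ^ 2 ≠ 0)]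
  simp only [← Complex.normSq_eq_norm_sq, Complex.normSq_apply, Complex.sub_re, Complex.sub_im,
    Complex.mul_re, Complex.mul_im, Complex.conj_re, Complex.conj_im, Complex.one_re,
    Complex.one_im]
  ring

theorem pseudoHyp_nonneg (z w : ℂ) : 0 ≤ pseudoHyp z w := by
  unfold pseudoHyp; positivity

theorem pseudoHyp_le_one {z w : ℂ} (hz : ‖z‖ ≤ 1) (hw : ‖w‖ < 1) : pseudoHyp z w ≤ 1 := by
  have h := one_sub_pseudoHyp_sq hz hw
  have : 0 ≤ 1 - pseudoHyp z w ^ 2 := by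
    rw [h]
    have : ‖z‖ ^ 2 ≤ 1 := pow_le_one₀ (norm_nonneg _) hz
    have : ‖w‖ ^ 2 ≤ 1 := pow_le_one₀ (norm_nonneg _) hw.le
    apply div_nonneg (mul_nonneg _ _) (by positivity) <;> linarith
  nlinarith [pseudoHyp_nonneg z w]

theorem norm_blaschkeFactor (a z : ℂ) : ‖blaschkeFactor a z‖ = pseudoHyp a z := by
  unfold blaschkeFactor pseudoHyp
  split_ifs with h
  · simp [h]
  · have : ‖a‖ ≠ 0 := norm_ne_zero_iff.2 h
    simp [this]

theorem norm_blaschkeFactor_le_one {a z : ℂ} (ha : ‖a‖ < 1) (hz : ‖z‖ < 1) :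
    ‖blaschkeFactor a z‖ ≤ 1 :=
  norm_blaschkeFactor a z ▸ pseudoHyp_le_one ha.le hz

theorem norm_blaschkeFactor_sub_one_le {a z : ℂ} (ha : ‖a‖ < 1) (hz : ‖z‖ < 1) :
    ‖blaschkeFactor a z - 1‖ ≤ 2 / (1 - ‖z‖) * (1 - ‖a‖) := by
  have hz' : 0 < 1 - ‖z‖ := sub_pos.2 hz
  unfold blaschkeFactor
  split_ifs with h
  · rw [h, norm_zero, sub_zero, mul_one, le_div_iff₀ hz']
    have := norm_sub_le z 1
    rw [norm_one] at this
    nlinarith [norm_nonneg z, norm_nonneg (z - 1)]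
  · have hd := norm_one_sub_conj_mul_pos ha.le hz
    have hd' : 1 - starRingEnd ℂ a * z ≠ 0 := norm_pos_iff.1 hd
    have hna : 0 < ‖a‖ := norm_pos_iff.2 h
    have hc : starRingEnd ℂ a * a = (‖a‖ : ℂ) ^ 2 := by
      rw [mul_comm, Complex.mul_conj, Complex.normSq_eq_norm_sq]; push_cast; rfl
    -- The normalisation makes `1 - |a|` split off, so the Blaschke condition gives a summable
    -- majorant.
    have e : (‖a‖ : ℂ) / a * ((a - z) / (1 - starRingEnd ℂ a * z)) - 1
        = -((1 - ‖a‖ : ℝ) * (a + ‖a‖ * z)) / (a * (1 - starRingEnd ℂ a * z)) := by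
      rw [div_mul_div_comm, div_sub_one (mul_ne_zero h hd')]
      congr 1
      push_cast
      linear_combination (z : ℂ) * hc
    rw [e, norm_div, norm_neg, norm_mul, norm_mul, Complex.norm_real, Real.norm_eq_abs,
      abs_of_pos (sub_pos.2 ha), div_mul_eq_mul_div, div_le_div_iff₀ (by positivity) hz']
    have h1 : ‖a + ‖a‖ * z‖ ≤ 2 * ‖a‖ := by
      refine (norm_add_le _ _).trans ?_
      rw [norm_mul, Complex.norm_real, norm_norm]
      nlinarith
    have h2 := one_sub_norm_le_norm_one_sub_conj_mul (w := z) ha.le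
    have : ‖a + ‖a‖ * z‖ * (1 - ‖z‖) ≤ 2 * ‖a‖ * ‖1 - starRingEnd ℂ a * z‖ := by gcongr
    nlinarith [sub_pos.2 ha]

theorem differentiableOn_blaschkeFactor {a : ℂ} (ha : ‖a‖ < 1) :
    DifferentiableOn ℂ (blaschkeFactor a) unitDisc := by
  intro z hz
  have hd' : 1 - starRingEnd ℂ a * z ≠ 0 :=
    norm_pos_iff.1 (norm_one_sub_conj_mul_pos ha.le (mem_unitDisc.1 hz))
  unfold blaschkeFactor
  split_ifs with h
  · fun_prop
  · apply DifferentiableAt.differentiableWithinAt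
    fun_prop (disch := assumption)

/-! ### Convergence and lower bounds of Blaschke products -/

section Product

variable {ι : Type*} {a : ι → ℂ}

/-- The limit of the product of the Blaschke factors. -/
noncomputable def blaschkeProd (a : ι → ℂ) (z : ℂ) : ℂ := ∏' i, blaschkeFactor (a i) z

theorem hasProdLocallyUniformlyOn_blaschkeProd (ha : ∀ i, ‖a i‖ < 1)
    (hs : Summable fun i => 1 - ‖a i‖) {R : ℝ} (hR : R < 1) :
    HasProdLocallyUniformlyOn (fun i => blaschkeFactor (a i)) (blaschkeProd a)
      (Metric.ball 0 R) := by
  have key := Summable.hasProdLocallyUniformlyOn_one_add (K := Metric.ball (0 : ℂ) R)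
    (f := fun i z => blaschkeFactor (a i) z - 1) (u := fun i => 2 / (1 - R) * (1 - ‖a i‖))
    Metric.isOpen_ball (hs.mul_left _) (Eventually.of_forall fun i z hz => ?_) (fun i => ?_)
  · simp only [add_sub_cancel] at key
    exact key
  · have hz' : ‖z‖ < R := by simpa using hz
    refine (norm_blaschkeFactor_sub_one_le (ha i) (hz'.trans hR)).trans ?_
    have := sub_pos.2 (ha i)
    have := sub_pos.2 hR
    gcongr
  · refine ((differentiableOn_blaschkeFactor (ha i)).continuousOn.mono ?_).sub continuousOn_const
    exact Metric.ball_subset_ball hR.le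

theorem exists_between_norm_one {z : ℂ} (hz : z ∈ unitDisc) :
    ∃ R < 1, z ∈ Metric.ball (0 : ℂ) R := by
  obtain ⟨R, h1, h2⟩ := exists_between (mem_unitDisc.1 hz)
  exact ⟨R, h2, by simpa using h1⟩

theorem hasProd_blaschkeProd (ha : ∀ i, ‖a i‖ < 1) (hs : Summable fun i => 1 - ‖a i‖)
    {z : ℂ} (hz : z ∈ unitDisc) :
    HasProd (fun i => blaschkeFactor (a i) z) (blaschkeProd a z) := by
  obtain ⟨R, h2, h1⟩ := exists_between_norm_one hz
  exact (hasProdLocallyUniformlyOn_blaschkeProd ha hs h2).hasProd h1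

theorem differentiableOn_blaschkeProd (ha : ∀ i, ‖a i‖ < 1) (hs : Summable fun i => 1 - ‖a i‖) :
    DifferentiableOn ℂ (blaschkeProd a) unitDisc := by
  intro z hz
  obtain ⟨R, h2, h1⟩ := exists_between_norm_one hz
  have h := hasProdLocallyUniformlyOn_iff_tendstoLocallyUniformlyOn.1
    (hasProdLocallyUniformlyOn_blaschkeProd ha hs h2)
  have hd := h.differentiableOn (Eventually.of_forall fun s => ?_) Metric.isOpen_ball
  · exact ((hd z h1).differentiableAt
      (Metric.isOpen_ball.mem_nhds h1)).differentiableWithinAt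
  · have : ∀ i ∈ s, DifferentiableOn ℂ (blaschkeFactor (a i)) (Metric.ball (0 : ℂ) R) :=
      fun i _ => (differentiableOn_blaschkeFactor (ha i)).mono (Metric.ball_subset_ball h2.le)
    exact DifferentiableOn.fun_finsetProd this

theorem norm_blaschkeProd_le_one (ha : ∀ i, ‖a i‖ < 1) (hs : Summable fun i => 1 - ‖a i‖)
    {z : ℂ} (hz : z ∈ unitDisc) : ‖blaschkeProd a z‖ ≤ 1 := by
  refine le_of_tendsto (hasProd_blaschkeProd ha hs hz).norm (Eventually.of_forall fun s => ?_)
  exact Finset.prod_le_one (fun _ _ => norm_nonneg _)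
    fun i _ => norm_blaschkeFactor_le_one (ha i) (mem_unitDisc.1 hz)

theorem exp_le_of_one_sub_le {κ y : ℝ} (hκ : 0 < κ) (hy : κ ≤ y) (hy1 : y ≤ 1) :
    Real.exp (-((1 - y) / κ)) ≤ y := by
  have hy0 : 0 < y := hκ.trans_le hy
  rw [← Real.le_log_iff_exp_le hy0]
  have h1 := Real.one_sub_inv_le_log_of_pos hy0
  have h2 : (1 - y) / y ≤ (1 - y) / κ := div_le_div_of_nonneg_left (by linarith) hκ hy
  have h3 : 1 - y⁻¹ = -((1 - y) / y) := by field_simp; ring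
  linarith

/-- Since `log y ≥ 1 - 1/y`, each factor satisfies `ρ² ≥ exp (-(1 - ρ²) / κ²)` once `ρ ≥ κ`.
Multiplying turns the bound on the sum into one on the product. -/
theorem exp_le_norm_blaschkeProd_sq (ha : ∀ i, ‖a i‖ < 1) (hs : Summable fun i => 1 - ‖a i‖)
    {z : ℂ} (hz : z ∈ unitDisc) {κ M : ℝ} (hκ : 0 < κ) (hsep : ∀ i, κ ≤ pseudoHyp (a i) z)
    (hM : ∀ s : Finset ι, ∑ i ∈ s, (1 - pseudoHyp (a i) z ^ 2) ≤ M) :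
    Real.exp (-(M / κ ^ 2)) ≤ ‖blaschkeProd a z‖ ^ 2 := by
  refine ge_of_tendsto ((hasProd_blaschkeProd ha hs hz).norm.pow 2)
    (Eventually.of_forall fun s => ?_)
  simp only [norm_blaschkeFactor]
  calc Real.exp (-(M / κ ^ 2))
      ≤ Real.exp (∑ i ∈ s, -((1 - pseudoHyp (a i) z ^ 2) / κ ^ 2)) := by
        rw [Finset.sum_neg_distrib, ← Finset.sum_div]
        have := hM s
        gcongr
    _ = ∏ i ∈ s, Real.exp (-((1 - pseudoHyp (a i) z ^ 2) / κ ^ 2)) := Real.exp_sum _ _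
    _ ≤ _ := by
        refine Finset.prod_le_prod (fun _ _ => (Real.exp_pos _).le) fun i _ => ?_
        refine exp_le_of_one_sub_le (by positivity) ?_ ?_
        · have := hsep i; gcongr
        · exact pow_le_one₀ (pseudoHyp_nonneg _ _) (pseudoHyp_le_one (ha i).le (mem_unitDisc.1 hz))

end Product

/-! ### Testing the Carleson condition on Cauchy kernels -/

/-- The normalisation-free test function `(1 - w̄ z)^(-2/p)`. -/
noncomputable def kernelPow (p : ℝ) (w z : ℂ) : ℂ :=
  (1 - starRingEnd ℂ w * z) ^ (((-2 / p : ℝ)) : ℂ)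

/-- The exponent `-2/p` removes `p` from the `p`-th power, so one computation serves every Carleson
exponent. -/
theorem enorm_kernelPow_rpow {p : ℝ} (hp : 0 < p) {w z : ℂ} (hw : ‖w‖ ≤ 1) (hz : ‖z‖ < 1) :
    ‖kernelPow p w z‖ₑ ^ p = ENNReal.ofReal (1 / ‖1 - starRingEnd ℂ w * z‖ ^ 2) := by
  have h := norm_one_sub_conj_mul_pos hw hz
  rw [← ofReal_norm, kernelPow, Complex.norm_cpow_real,
    ENNReal.ofReal_rpow_of_pos (Real.rpow_pos_of_pos h _), ← Real.rpow_mul h.le,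
    div_mul_cancel₀ _ hp.ne', Real.rpow_neg h.le, one_div]
  norm_num

theorem isAnalyticInDisc_kernelPow (p : ℝ) {w : ℂ} (hw : ‖w‖ ≤ 1) :
    IsAnalyticInDisc (kernelPow p w) := by
  intro z hz
  have hz := mem_unitDisc.1 hz
  have hs : 1 - starRingEnd ℂ w * z ∈ Complex.slitPlane := by
    have : ‖starRingEnd ℂ w * z‖ < 1 := by
      rw [norm_mul, RCLike.norm_conj]; nlinarith [norm_nonneg z]
    left
    have := (Complex.re_le_norm (starRingEnd ℂ w * z)).trans_lt this
    simpa using this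
  unfold kernelPow
  have hd : DifferentiableAt ℂ (fun z => 1 - starRingEnd ℂ w * z) z := by fun_prop
  exact (hd.cpow_const hs).differentiableWithinAt

/-- On the unit circle `|1 - w̄z| = |z - w|`, so up to the factor `1 - |w|²` the integrand is the
Poisson kernel, of mean `1`. -/
theorem circleAverage_inv_norm_sq {w : ℂ} (hw : ‖w‖ < 1) :
    Real.circleAverage (fun z => 1 / ‖1 - starRingEnd ℂ w * z‖ ^ 2) 0 1 = 1 / (1 - ‖w‖ ^ 2) := by
  have h := DiffContOnCl.circleAverage_poissonKernel_smul' (f := fun _ => (1 : ℂ)) (c := 0)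
    (R := 1) (w := w) diffContOnCl_const (by simpa using hw)
  have hw2 : 0 < 1 - ‖w‖ ^ 2 := by nlinarith [norm_nonneg w]
  rw [eq_div_iff hw2.ne', mul_comm, ← smul_eq_mul, ← Real.circleAverage_fun_smul,
    ← Complex.ofReal_inj]
  have hr (F : ℂ → ℝ) : ((Real.circleAverage F 0 1 : ℝ) : ℂ)
      = Real.circleAverage (fun z => (F z : ℂ)) 0 1 := by
    simp [Real.circleAverage_def, intervalIntegral.integral_ofReal]
  rw [hr, Complex.ofReal_one]
  refine Eq.trans ?_ h
  refine Real.circleAverage_congr_sphere fun z hz => ?_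
  have hz : ‖z‖ = 1 := by simpa using hz
  have e : ‖1 - starRingEnd ℂ w * z‖ = ‖z - w‖ := by
    have hc : z * starRingEnd ℂ z = 1 := by
      rw [Complex.mul_conj, Complex.normSq_eq_norm_sq, hz]; simp
    rw [norm_one_sub_conj_mul_comm, ← one_mul ‖_‖, ← hz, ← norm_mul]
    congr 1
    linear_combination -w * hc
  simp [hz, e, div_eq_mul_inv]

theorem lintegral_circle_inv_norm_sq {w : ℂ} (hw : ‖w‖ < 1) {r : ℝ} (h0 : 0 < r) (hr : r < 1) :
    ENNReal.ofReal (1 / (2 * Real.pi)) * ∫⁻ θ in Ioc (0 : ℝ) (2 * Real.pi),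
      ENNReal.ofReal (1 / ‖1 - starRingEnd ℂ w * circleMap 0 r θ‖ ^ 2)
      ≤ ENNReal.ofReal (1 / (1 - ‖w‖ ^ 2)) := by
  have hrw : ‖(r : ℂ) * w‖ < 1 := by
    rw [norm_mul, Complex.norm_real, Real.norm_of_nonneg h0.le]; nlinarith [norm_nonneg w]
  have hcont : Continuous fun θ : ℝ => 1 / ‖1 - starRingEnd ℂ w * circleMap 0 r θ‖ ^ 2 := by
    refine continuous_const.div (by fun_prop) fun θ => ?_
    have : ‖circleMap 0 r θ‖ < 1 := by simpa [abs_of_pos h0] using hr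
    have := norm_one_sub_conj_mul_pos hw.le this
    positivity
  -- The radius is absorbed into the point: the circle of radius `r` with `w` becomes the unit
  -- circle with `r w`.
  have h := circleAverage_inv_norm_sq hrw
  rw [Real.circleAverage_def, intervalIntegral.integral_of_le (by positivity)] at h
  rw [← ofReal_integral_eq_lintegral_ofReal, ← ENNReal.ofReal_mul (by positivity)]
  · apply ENNReal.ofReal_le_ofReal
    calc _ = 1 / (1 - ‖(r : ℂ) * w‖ ^ 2) := by
          rw [← h, smul_eq_mul, one_div]
          congr 2
          ext θ
          simp [circleMap, mul_assoc, mul_left_comm]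
      _ ≤ _ := by
          have : ‖w‖ ^ 2 < 1 := by nlinarith [norm_nonneg w]
          have : ‖(r : ℂ) * w‖ ≤ ‖w‖ := by
            rw [norm_mul, Complex.norm_real, Real.norm_of_nonneg h0.le]; nlinarith [norm_nonneg w]
          gcongr
  · exact (hcont.integrableOn_Icc).mono_set Ioc_subset_Icc_self
  · exact Eventually.of_forall fun θ => by positivity

theorem hardyNorm_kernelPow_rpow_le {p : ℝ} (hp : 0 < p) {w : ℂ} (hw : ‖w‖ < 1) :
    hardyNorm p (kernelPow p w) ^ p ≤ ENNReal.ofReal (1 / (1 - ‖w‖ ^ 2)) := by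
  have : hardyNorm p (kernelPow p w) ≤ ENNReal.ofReal (1 / (1 - ‖w‖ ^ 2)) ^ (1 / p) := by
    refine limsup_le_of_le (by isBoundedDefault) ?_
    have : ∀ᶠ r : ℝ in 𝓝[<] 1, r ∈ Ioo (0 : ℝ) 1 := Ioo_mem_nhdsLT zero_lt_one
    filter_upwards [this] with r hr
    refine ENNReal.rpow_le_rpow ?_ (by positivity)
    refine le_of_eq_of_le ?_ (lintegral_circle_inv_norm_sq hw hr.1 hr.2)
    congr 1
    refine lintegral_congr fun θ => ?_
    exact enorm_kernelPow_rpow hp hw.le (by simpa [abs_of_pos hr.1] using hr.2)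
  calc _ ≤ (ENNReal.ofReal (1 / (1 - ‖w‖ ^ 2)) ^ (1 / p)) ^ p :=
        ENNReal.rpow_le_rpow this hp.le
    _ = _ := by rw [← ENNReal.rpow_mul, one_div_mul_cancel hp.ne', ENNReal.rpow_one]

theorem memHardy_kernelPow {p : ℝ} (hp : 0 < p) {w : ℂ} (hw : ‖w‖ < 1) :
    MemHardy p (kernelPow p w) := by
  refine ⟨isAnalyticInDisc_kernelPow p hw.le, ?_⟩
  have := (hardyNorm_kernelPow_rpow_le hp hw).trans_lt ENNReal.ofReal_lt_top
  exact (ENNReal.rpow_lt_top_iff_of_pos hp).1 this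

/-- A Carleson measure supported on a sequence has uniformly bounded invariant sums. -/
theorem UniformlySeparated.exists_sum_one_sub_pseudoHyp_sq_le {ι : Type*} [Countable ι]
    {a : ι → ℂ} (ha : UniformlySeparated a) :
    ∃ M : ℝ, 0 < M ∧ ∀ w ∈ unitDisc, ∀ s : Finset ι,
      ∑ i ∈ s, (1 - pseudoHyp (a i) w ^ 2) ≤ M := by
  obtain ⟨hD, -, p, hp, C, hC⟩ := ha
  -- The bound proper is `2 C`; the `+ 1` only ensures positivity.
  refine ⟨2 * C + 1, by positivity, fun w hw s => ?_⟩
  have hw' := mem_unitDisc.1 hw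
  have hw2 : 0 < 1 - ‖w‖ ^ 2 := by nlinarith [norm_nonneg w]
  have hD' : ∀ i, ‖a i‖ < 1 := fun i => mem_unitDisc.1 (hD i)
  have h := hC _ (memHardy_kernelPow hp hw')
  replace h := h.trans (mul_le_mul_right (hardyNorm_kernelPow_rpow_le hp hw') _)
  rw [Measure.restrict_sum _ isOpen_unitDisc.measurableSet, lintegral_sum_measure] at h
  replace h := (ENNReal.sum_le_tsum s).trans h
  have e : ∀ i, ∫⁻ z, ‖kernelPow p w z‖ₑ ^ p ∂((ENNReal.ofReal (1 - ‖a i‖) •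
      Measure.dirac (a i)).restrict unitDisc)
      = ENNReal.ofReal ((1 - ‖a i‖) * (1 / ‖1 - starRingEnd ℂ w * a i‖ ^ 2)) := by
    intro i
    classical
    rw [Measure.restrict_smul, lintegral_smul_measure, setLIntegral_dirac, if_pos (hD i),
      enorm_kernelPow_rpow hp hw'.le (hD' i), smul_eq_mul,
      ENNReal.ofReal_mul (sub_nonneg.2 (hD' i).le)]
  simp only [e] at h
  have hnn : ∀ i, 0 ≤ (1 - ‖a i‖) * (1 / ‖1 - starRingEnd ℂ w * a i‖ ^ 2) := fun i =>
    mul_nonneg (sub_nonneg.2 (hD' i).le) (by positivity)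
  rw [← ENNReal.ofReal_sum_of_nonneg fun i _ => hnn i, ← ENNReal.ofReal_coe_nnreal,
    ← ENNReal.ofReal_mul C.coe_nonneg, ENNReal.ofReal_le_ofReal_iff (by positivity)] at h
  calc ∑ i ∈ s, (1 - pseudoHyp (a i) w ^ 2)
      ≤ ∑ i ∈ s, (2 * (1 - ‖w‖ ^ 2)) *
          ((1 - ‖a i‖) * (1 / ‖1 - starRingEnd ℂ w * a i‖ ^ 2)) := by
        refine Finset.sum_le_sum fun i _ => ?_
        rw [one_sub_pseudoHyp_sq (hD' i).le hw', norm_one_sub_conj_mul_comm, div_eq_mul_one_div,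
          ← mul_assoc]
        refine mul_le_mul_of_nonneg_right ?_ (by positivity)
        have : 1 - ‖a i‖ ^ 2 ≤ 2 * (1 - ‖a i‖) := by nlinarith [sq_nonneg (1 - ‖a i‖)]
        nlinarith
    _ = 2 * (1 - ‖w‖ ^ 2) * ∑ i ∈ s, ((1 - ‖a i‖) * (1 / ‖1 - starRingEnd ℂ w * a i‖ ^ 2)) := by
        rw [Finset.mul_sum]
    _ ≤ 2 * (1 - ‖w‖ ^ 2) * (C * (1 / (1 - ‖w‖ ^ 2))) := by gcongr
    _ ≤ 2 * C + 1 := by field_simp; linarith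

theorem summable_one_sub_norm {ι : Type*} {a : ι → ℂ} (hD : ∀ i, ‖a i‖ < 1) {M : ℝ}
    (hM : ∀ s : Finset ι, ∑ i ∈ s, (1 - pseudoHyp (a i) 0 ^ 2) ≤ M) :
    Summable fun i => 1 - ‖a i‖ := by
  refine summable_of_sum_le (c := M) (fun i => sub_nonneg.2 (hD i).le) fun s => ?_
  refine (Finset.sum_le_sum fun i _ => ?_).trans (hM s)
  simp only [pseudoHyp, sub_zero, mul_zero, norm_one, div_one]
  nlinarith [norm_nonneg (a i), hD i]

/-! ### Separation in Euclidean terms -/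

/-- From `1 - āz = (1 - |a|²) - ā (z - a)`, with `t = |z - a|`, the distance is at least `t / (2 (1
- |a|) + t)`, which increases with `t`. -/
theorem le_pseudoHyp_of_le_norm_sub {a z : ℂ} {η : ℝ} (hη : 0 < η) (ha : ‖a‖ < 1) (hz : ‖z‖ < 1)
    (h : η * (1 - ‖a‖) ≤ ‖z - a‖) : η / (2 + η) ≤ pseudoHyp a z := by
  have hd := norm_one_sub_conj_mul_pos ha.le hz
  have h1 : ‖1 - starRingEnd ℂ a * z‖ ≤ 2 * (1 - ‖a‖) + ‖z - a‖ := by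
    have hc : starRingEnd ℂ a * a = (‖a‖ : ℂ) ^ 2 := by
      rw [mul_comm, Complex.mul_conj, Complex.normSq_eq_norm_sq]; push_cast; rfl
    have e : 1 - starRingEnd ℂ a * z = ((1 - ‖a‖ ^ 2 : ℝ) : ℂ) - starRingEnd ℂ a * (z - a) := by
      push_cast
      linear_combination -hc
    rw [e]
    refine (norm_sub_le _ _).trans ?_
    rw [norm_mul, RCLike.norm_conj, Complex.norm_real, Real.norm_of_nonneg
      (by nlinarith [norm_nonneg a])]
    nlinarith [norm_nonneg a, norm_nonneg (z - a), sq_nonneg (1 - ‖a‖)]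
  rw [pseudoHyp, norm_sub_rev, div_le_div_iff₀ (by positivity) hd]
  nlinarith

theorem IsSeparated.exists_mul_le_norm_sub {ι : Type*} {a : ι → ℂ} (h : IsSeparated a)
    (ha : ∀ i, ‖a i‖ < 1) :
    ∃ δ : ℝ, 0 < δ ∧ δ < 1 ∧ ∀ i j, i ≠ j → δ * (1 - ‖a i‖) ≤ ‖a i - a j‖ := by
  obtain ⟨δ, h0, h1, h⟩ := h
  refine ⟨δ, h0, h1, fun i j hij => ?_⟩
  have h2 := h i j hij
  have h3 := one_sub_norm_le_norm_one_sub_conj_mul (w := a i) (ha j).le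
  have h4 := norm_one_sub_conj_mul_pos (ha i).le (ha j)
  rw [pseudoHyp, lt_div_iff₀ h4, norm_one_sub_conj_mul_comm] at h2
  nlinarith

/-- The mean of the separation bounds seen from `a_i` and from `a_k` is `|a_i - a_k| ≥ (δ/2) ((1 -
|a_i|) + (1 - |a_k|))`, so the discs of radius `η (1 - |a_i|)` do not overlap. -/
theorem mul_le_norm_sub_of_norm_sub_le {ι : Type*} {a : ι → ℂ} {δ η : ℝ} (hη : η ≤ δ / 2)
    (ha : ∀ i, ‖a i‖ < 1) (hsep : ∀ i j, i ≠ j → δ * (1 - ‖a i‖) ≤ ‖a i - a j‖) {z : ℂ} {i k : ι}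
    (hik : i ≠ k) (hz : ‖z - a i‖ ≤ η * (1 - ‖a i‖)) : η * (1 - ‖a k‖) ≤ ‖z - a k‖ := by
  have h1 := hsep i k hik
  have h2 := hsep k i hik.symm
  rw [norm_sub_rev] at h2
  have h3 := norm_sub_le_norm_sub_add_norm_sub (a i) z (a k)
  rw [norm_sub_rev (a i) z] at h3
  nlinarith [ha i, ha k]

theorem exists_blaschkeFactor_eq {a : ℂ} (ha : ‖a‖ < 1) :
    ∃ k : ℂ → ℂ, DifferentiableOn ℂ k unitDisc ∧ k a ≠ 0 ∧
      ∀ z, blaschkeFactor a z = (z - a) * k z := by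
  by_cases h : a = 0
  · exact ⟨fun _ => 1, differentiableOn_const _, one_ne_zero, fun z => by simp [blaschkeFactor, h]⟩
  · have hd {z : ℂ} (hz : ‖z‖ < 1) : 1 - starRingEnd ℂ a * z ≠ 0 :=
      norm_pos_iff.1 (norm_one_sub_conj_mul_pos ha.le hz)
    refine ⟨fun z => -(‖a‖ / a) / (1 - starRingEnd ℂ a * z), fun z hz => ?_, ?_, fun z => ?_⟩
    · have := hd (mem_unitDisc.1 hz)
      apply DifferentiableAt.differentiableWithinAt
      fun_prop (disch := assumption)
    · have := hd ha
      simp [h, this]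
    · simp only [blaschkeFactor, h, if_false]
      ring

/-! ### Zeros and size of Blaschke products over separated sequences -/

section Blaschke

variable {ι : Type*} {a : ι → ℂ} {B : ℂ → ℂ}

theorem IsBlaschkeProduct.exists_eq (hB : IsBlaschkeProduct B a) :
    ∃ c : ℂ, ‖c‖ = 1 ∧ EqOn B (fun z => c * blaschkeProd a z) unitDisc := by
  obtain ⟨-, -, c, P, hc, h⟩ := hB
  refine ⟨c, hc, fun z hz => ?_⟩
  simp only [(h z hz).2, blaschkeProd, (h z hz).1.tprod_eq]

theorem isBlaschkeProduct_blaschkeProd (ha : ∀ i, ‖a i‖ < 1)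
    (hs : Summable fun i => 1 - ‖a i‖) : IsBlaschkeProduct (blaschkeProd a) a :=
  ⟨fun i => mem_unitDisc.2 (ha i), hs, 1, blaschkeProd a, norm_one,
    fun _ hz => ⟨hasProd_blaschkeProd ha hs hz, (one_mul _).symm⟩⟩

theorem IsBlaschkeProduct.norm_lt_one (hB : IsBlaschkeProduct B a) (i : ι) : ‖a i‖ < 1 :=
  mem_unitDisc.1 (hB.1 i)

theorem IsBlaschkeProduct.differentiableOn (hB : IsBlaschkeProduct B a) :
    DifferentiableOn ℂ B unitDisc := by
  obtain ⟨c, -, h⟩ := hB.exists_eq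
  exact ((differentiableOn_blaschkeProd hB.norm_lt_one hB.2.1).const_mul c).congr h

theorem IsBlaschkeProduct.norm_eq (hB : IsBlaschkeProduct B a) {z : ℂ} (hz : z ∈ unitDisc) :
    ‖B z‖ = ‖blaschkeProd a z‖ := by
  obtain ⟨c, hc, h⟩ := hB.exists_eq
  rw [h hz, norm_mul, hc, one_mul]

theorem IsBlaschkeProduct.norm_le_one (hB : IsBlaschkeProduct B a) {z : ℂ} (hz : z ∈ unitDisc) :
    ‖B z‖ ≤ 1 :=
  hB.norm_eq hz ▸ norm_blaschkeProd_le_one hB.norm_lt_one hB.2.1 hz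

/-- The Blaschke product is bounded away from zero outside the discs `|z - a_i| < η (1 - |a_i|)`. -/
theorem IsBlaschkeProduct.exists_le_norm (hB : IsBlaschkeProduct B a) {M : ℝ}
    (hM : ∀ w ∈ unitDisc, ∀ s : Finset ι, ∑ i ∈ s, (1 - pseudoHyp (a i) w ^ 2) ≤ M)
    {η : ℝ} (hη : 0 < η) :
    ∃ c : ℝ, 0 < c ∧ ∀ z ∈ unitDisc, (∀ i, η * (1 - ‖a i‖) ≤ ‖z - a i‖) → c ≤ ‖B z‖ := by
  refine ⟨Real.sqrt (Real.exp (-(M / (η / (2 + η)) ^ 2))), by positivity, fun z hz h => ?_⟩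
  rw [hB.norm_eq hz]
  refine Real.sqrt_le_iff.2 ⟨norm_nonneg _, ?_⟩
  exact exp_le_norm_blaschkeProd_sq hB.norm_lt_one hB.2.1 hz (by positivity)
    (fun i => le_pseudoHyp_of_le_norm_sub hη (hB.norm_lt_one i) (mem_unitDisc.1 hz) (h i)) (hM z hz)

theorem blaschkeProd_eq_mul (ha : ∀ i, ‖a i‖ < 1) (hs : Summable fun i => 1 - ‖a i‖) (i : ι)
    {z : ℂ} (hz : z ∈ unitDisc) :
    blaschkeProd a z =
      blaschkeFactor (a i) z * blaschkeProd (fun j : ({i}ᶜ : Set ι) => a j) z := by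
  have h1 := hasProd_blaschkeProd (a := fun j : ({i}ᶜ : Set ι) => a j) (fun j => ha j)
    (hs.subtype _) hz
  have h2 : HasProd ((fun j => blaschkeFactor (a j) z) ∘ ((↑) : ({i} : Set ι) → ι))
      (blaschkeFactor (a i) z) := by
    convert hasProd_unique _
    rfl
  exact (hasProd_blaschkeProd ha hs hz).unique (h2.mul_compl h1)

theorem IsBlaschkeProduct.eq_zero_and_deriv_ne_zero (hB : IsBlaschkeProduct B a)
    (hS : IsSeparated a) {M : ℝ}
    (hM : ∀ w ∈ unitDisc, ∀ s : Finset ι, ∑ i ∈ s, (1 - pseudoHyp (a i) w ^ 2) ≤ M) (i : ι) :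
    B (a i) = 0 ∧ deriv B (a i) ≠ 0 := by
  obtain ⟨c, hc, h⟩ := hB.exists_eq
  obtain ⟨k, hk, hk0, hbk⟩ := exists_blaschkeFactor_eq (hB.norm_lt_one i)
  set Q := blaschkeProd (fun j : ({i}ᶜ : Set ι) => a j)
  have ha' : ∀ j : ({i}ᶜ : Set ι), ‖a j‖ < 1 := fun j => hB.norm_lt_one j
  have hs' : Summable fun j : ({i}ᶜ : Set ι) => 1 - ‖a j‖ := hB.2.1.subtype _
  have hnhds : unitDisc ∈ 𝓝 (a i) := isOpen_unitDisc.mem_nhds (hB.1 i)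
  have hQ : DifferentiableAt ℂ Q (a i) :=
    (differentiableOn_blaschkeProd ha' hs').differentiableAt hnhds
  -- The remaining zeros are at distance at least `δ` from `a_i`, and their sums are still bounded
  -- by `M`.
  have hQ0 : Q (a i) ≠ 0 := by
    obtain ⟨δ, hδ, -, hsep⟩ := hS
    have := exp_le_norm_blaschkeProd_sq ha' hs' (hB.1 i) hδ
      (fun j => (hsep j i j.2).le) (M := M) (fun s => ?_)
    · intro h0
      rw [show blaschkeProd (fun j : ({i}ᶜ : Set ι) => a j) (a i) = 0 from h0] at this
      simp only [norm_zero, ne_eq, OfNat.ofNat_ne_zero, not_false_eq_true, zero_pow] at this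
      exact absurd this (not_le.2 (Real.exp_pos _))
    · have := hM (a i) (hB.1 i) (s.map (Function.Embedding.subtype _))
      simpa using this
  have hBK : EqOn B (fun z => (z - a i) * (c * (k z * Q z))) unitDisc := fun z hz => by
    rw [h hz]
    simp only
    rw [blaschkeProd_eq_mul hB.norm_lt_one hB.2.1 i hz, hbk]
    ring
  refine ⟨by rw [hBK (hB.1 i)]; simp, ?_⟩
  have hK : DifferentiableAt ℂ (fun z => c * (k z * Q z)) (a i) :=
    ((hk.differentiableAt hnhds).mul hQ).const_mul c
  have hder := ((hasDerivAt_id (a i)).sub_const (a i)).mul hK.hasDerivAt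
  have hder' := hder.congr_of_eventuallyEq (f₁ := B)
    (Filter.eventuallyEq_of_mem hnhds hBK)
  rw [hder'.deriv]
  have hc0 : c ≠ 0 := by
    rw [← norm_pos_iff, hc]; exact one_pos
  simp [hc0, hk0, hQ0]

/-- Off the sequence, `z` lies in at most one disc of relative radius `δ/2`. Shrinking the radii,
depending on `z`, puts it outside all of them, where `|B|` has a positive lower bound. -/
theorem IsBlaschkeProduct.exists_eq_of_eq_zero (hB : IsBlaschkeProduct B a)
    (hS : IsSeparated a) {M : ℝ}
    (hM : ∀ w ∈ unitDisc, ∀ s : Finset ι, ∑ i ∈ s, (1 - pseudoHyp (a i) w ^ 2) ≤ M)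
    {z : ℂ} (hz : z ∈ unitDisc) (h0 : B z = 0) : ∃ i, a i = z := by
  by_contra! hne
  obtain ⟨δ, hδ, -, hsep⟩ := hS.exists_mul_le_norm_sub hB.norm_lt_one
  obtain ⟨η, hη, hE⟩ : ∃ η > 0, ∀ i, η * (1 - ‖a i‖) ≤ ‖z - a i‖ := by
    by_cases hcase : ∀ i, δ / 2 * (1 - ‖a i‖) ≤ ‖z - a i‖
    · exact ⟨δ / 2, by positivity, hcase⟩
    · push Not at hcase
      obtain ⟨i, hi⟩ := hcase
      have hpos : 0 < ‖z - a i‖ := norm_pos_iff.2 (sub_ne_zero.2 (hne i).symm)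
      refine ⟨min (δ / 2) ‖z - a i‖, by positivity, fun k => ?_⟩
      have hk := hB.norm_lt_one k
      by_cases hik : i = k
      · subst hik
        have := min_le_right (δ / 2) ‖z - a i‖
        nlinarith [norm_nonneg (a i)]
      · have := mul_le_norm_sub_of_norm_sub_le le_rfl hB.norm_lt_one hsep hik hi.le
        have := min_le_left (δ / 2) ‖z - a i‖
        nlinarith
  obtain ⟨c, hc, h⟩ := hB.exists_le_norm hM hη
  have := h z hz hE
  rw [h0, norm_zero] at this
  linarith

end Blaschke

/-! ### Maximum principle, division by `B`, and Cauchy estimates -/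

theorem closedBall_subset_unitDisc {a : ℂ} {η : ℝ} (ha : ‖a‖ < 1) (hη : η < 1) :
    Metric.closedBall a (η * (1 - ‖a‖)) ⊆ unitDisc := by
  intro z hz
  rw [mem_closedBall_iff_norm] at hz
  rw [mem_unitDisc]
  have := norm_le_norm_add_norm_sub' z a
  nlinarith

theorem norm_le_of_forall_sphere {F : ℂ → ℂ} (hF : DifferentiableOn ℂ F unitDisc) {a z : ℂ}
    {η C : ℝ} (ha : ‖a‖ < 1) (hη : 0 < η) (hη1 : η < 1) (hz : ‖z - a‖ ≤ η * (1 - ‖a‖))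
    (hC : ∀ w, ‖w - a‖ = η * (1 - ‖a‖) → ‖F w‖ ≤ C) : ‖F z‖ ≤ C := by
  have hR : 0 < η * (1 - ‖a‖) := mul_pos hη (sub_pos.2 ha)
  have hd : DiffContOnCl ℂ F (Metric.ball a (η * (1 - ‖a‖))) :=
    hF.diffContOnCl_ball (closedBall_subset_unitDisc ha hη1)
  refine Complex.norm_le_of_forall_mem_frontier_norm_le Metric.isBounded_ball hd (fun w hw => ?_) ?_
  · rw [frontier_ball _ hR.ne', mem_sphere_iff_norm] at hw
    exact hC w hw
  · rw [closure_ball _ hR.ne', mem_closedBall_iff_norm]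
    exact hz

/-- A function vanishing at the zeros of `B`, all of them simple, is divisible by `B`. -/
theorem exists_eq_mul_of_simple_zeros {B h : ℂ → ℂ} (hB : DifferentiableOn ℂ B unitDisc)
    (hh : DifferentiableOn ℂ h unitDisc)
    (h0 : ∀ z ∈ unitDisc, B z = 0 → deriv B z ≠ 0 ∧ h z = 0) :
    ∃ q : ℂ → ℂ, DifferentiableOn ℂ q unitDisc ∧ ∀ z ∈ unitDisc, h z = B z * q z := by
  classical
  refine ⟨fun z => if B z = 0 then deriv h z / deriv B z else h z / B z, fun z hz => ?_,
    fun z hz => ?_⟩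
  · have hn : unitDisc ∈ 𝓝 z := isOpen_unitDisc.mem_nhds hz
    apply DifferentiableAt.differentiableWithinAt
    by_cases hBz : B z = 0
    · obtain ⟨hB', hhz⟩ := h0 z hz hBz
      have h1 := ((Complex.differentiableOn_dslope hn).2 hh).differentiableAt hn
      have h2 := ((Complex.differentiableOn_dslope hn).2 hB).differentiableAt hn
      have h3 : dslope B z z ≠ 0 := by rwa [dslope_same]
      -- Near a zero `z` of `B`, the common factor `w - z` cancels and the quotient is that of the
      -- difference quotients, whose denominator stays nonzero.
      refine (h1.div h2 h3).congr_of_eventuallyEq ?_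
      filter_upwards [h2.continuousAt.eventually_ne h3] with w hw
      have eB := sub_smul_dslope B z w
      have eh := sub_smul_dslope h z w
      rw [hBz, sub_zero, smul_eq_mul] at eB
      rw [hhz, sub_zero, smul_eq_mul] at eh
      by_cases hwz : w = z
      · simp [hwz, hBz]
      · have hwz' : w - z ≠ 0 := sub_ne_zero.2 hwz
        rw [if_neg (eB ▸ mul_ne_zero hwz' hw), ← eB, ← eh, mul_div_mul_left _ _ hwz', Pi.div_apply]
    · have h2 := hB.differentiableAt hn
      refine ((hh.differentiableAt hn).div h2 hBz).congr_of_eventuallyEq ?_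
      filter_upwards [h2.continuousAt.eventually_ne hBz] with w hw
      simp [hw]
  · by_cases hBz : B z = 0
    · simp [hBz, (h0 z hz hBz).2]
    · simp only [hBz, if_false]
      field_simp

/-- Cauchy's estimate for functions of polynomial growth at the boundary. -/
theorem norm_deriv_le_div_pow {h : ℂ → ℂ} (hh : DifferentiableOn ℂ h unitDisc) {C : ℝ} {k : ℕ}
    (hC : ∀ z ∈ unitDisc, ‖h z‖ ≤ C / (1 - ‖z‖) ^ k) {z : ℂ} (hz : z ∈ unitDisc) :
    ‖deriv h z‖ ≤ (2 ^ (k + 1) * C) / (1 - ‖z‖) ^ (k + 1) := by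
  have hz1 := mem_unitDisc.1 hz
  have hpos : 0 < 1 - ‖z‖ := sub_pos.2 hz1
  have hC0 : 0 ≤ C := by
    have := (norm_nonneg _).trans (hC z hz)
    by_contra! hneg
    exact absurd this (not_le.2 (div_neg_of_neg_of_pos hneg (by positivity)))
  have hsub : Metric.closedBall z (1 / 2 * (1 - ‖z‖)) ⊆ unitDisc :=
    closedBall_subset_unitDisc hz1 (by norm_num)
  have := Complex.norm_deriv_le_of_forall_mem_sphere_norm_le (c := z) (R := 1 / 2 * (1 - ‖z‖))
    (C := 2 ^ k * C / (1 - ‖z‖) ^ k) (by positivity) (hh.diffContOnCl_ball hsub) fun w hw => ?_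
  · refine this.trans_eq ?_
    field_simp
    ring
  · have hwD := hsub (Metric.sphere_subset_closedBall hw)
    refine (hC w hwD).trans ?_
    rw [mem_sphere_iff_norm] at hw
    have h1 := norm_le_norm_add_norm_sub' w z
    have h2 : (1 - ‖z‖) / 2 ≤ 1 - ‖w‖ := by linarith
    calc C / (1 - ‖w‖) ^ k ≤ C / ((1 - ‖z‖) / 2) ^ k := by gcongr
      _ = _ := by rw [div_pow]; field_simp

section Separated

variable {ι : Type*} {a : ι → ℂ}

/-- Near each point of the disc there is a point away from the sequence at which a given
analytic function is at least as large in modulus. -/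
theorem exists_norm_le_away {δ : ℝ} (ha : ∀ i, ‖a i‖ < 1)
    (hsep : ∀ i j, i ≠ j → δ * (1 - ‖a i‖) ≤ ‖a i - a j‖) {η : ℝ} (hη : 0 < η) (hηδ : η ≤ δ / 2)
    (hη1 : η ≤ 1 / 32) {F : ℂ → ℂ} (hF : DifferentiableOn ℂ F unitDisc) {z : ℂ}
    (hz : z ∈ unitDisc) :
    ∃ w ∈ unitDisc, (∀ i, η * (1 - ‖a i‖) ≤ ‖w - a i‖) ∧ ‖w - z‖ ≤ (1 - ‖z‖) / 8 ∧
      ‖F z‖ ≤ ‖F w‖ := by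
  have hz1 := mem_unitDisc.1 hz
  by_cases hcase : ∀ i, η * (1 - ‖a i‖) ≤ ‖z - a i‖
  · exact ⟨z, hz, hcase, by rw [sub_self, norm_zero]; linarith, le_rfl⟩
  push Not at hcase
  obtain ⟨i, hi⟩ := hcase
  have hai := ha i
  have hR : 0 < η * (1 - ‖a i‖) := mul_pos hη (sub_pos.2 hai)
  have hsub : Metric.closedBall (a i) (η * (1 - ‖a i‖)) ⊆ unitDisc :=
    closedBall_subset_unitDisc hai (by linarith)
  have hsub' := Metric.sphere_subset_closedBall.trans hsub
  obtain ⟨w, hw, hmax⟩ := (isCompact_sphere (a i) (η * (1 - ‖a i‖))).exists_isMaxOn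
    (NormedSpace.sphere_nonempty.2 hR.le) (hF.continuousOn.norm.mono hsub')
  have hw' := mem_sphere_iff_norm.1 hw
  refine ⟨w, hsub' hw, fun k => ?_, ?_, ?_⟩
  · by_cases hik : i = k
    · subst hik; exact hw'.ge
    · exact mul_le_norm_sub_of_norm_sub_le hηδ ha hsep hik hw'.le
  -- Here `|w - z| ≤ 2 η (1 - |a_i|)` and `(1 - η) (1 - |a_i|) ≤ 1 - |z|`; with `η ≤ 1/32` this
  -- gives `2/31 < 1/8`.
  · have h1 := norm_sub_le_norm_sub_add_norm_sub w (a i) z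
    rw [norm_sub_rev (a i) z] at h1
    have h2 := norm_le_norm_add_norm_sub' z (a i)
    nlinarith
  · exact norm_le_of_forall_sphere hF hai hη (by linarith) hi.le
      fun v hv => hmax (mem_sphere_iff_norm.2 hv)

end Separated

/-! ### Derivatives of `B e^g` and growth conditions -/

theorem deriv_mul_exp {B g : ℂ → ℂ} (hB : DifferentiableOn ℂ B unitDisc)
    (hg : DifferentiableOn ℂ g unitDisc) {z : ℂ} (hz : z ∈ unitDisc) :
    deriv (fun w => B w * Complex.exp (g w)) z
      = (deriv B z + B z * deriv g z) * Complex.exp (g z) := by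
  have hn := isOpen_unitDisc.mem_nhds hz
  have := (hB.differentiableAt hn).hasDerivAt.mul (hg.differentiableAt hn).hasDerivAt.cexp
  refine this.deriv.trans ?_
  ring

theorem deriv_deriv_mul_exp {B g : ℂ → ℂ} (hB : DifferentiableOn ℂ B unitDisc)
    (hg : DifferentiableOn ℂ g unitDisc) {z : ℂ} (hz : z ∈ unitDisc) :
    deriv (deriv fun w => B w * Complex.exp (g w)) z
      = (deriv (deriv B) z + 2 * deriv B z * deriv g z
          + B z * (deriv (deriv g) z + deriv g z ^ 2)) * Complex.exp (g z) := by
  have hn := isOpen_unitDisc.mem_nhds hz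
  have e : deriv (fun w => B w * Complex.exp (g w)) =ᶠ[𝓝 z]
      fun w => (deriv B w + B w * deriv g w) * Complex.exp (g w) :=
    eventuallyEq_of_mem hn fun w hw => deriv_mul_exp hB hg hw
  have hB' := hB.deriv isOpen_unitDisc
  have hg' := hg.deriv isOpen_unitDisc
  rw [e.deriv_eq]
  refine (deriv_mul_exp (hB'.add (hB.mul hg')) hg hz).trans ?_
  have hd := ((hB'.differentiableAt hn).hasDerivAt.add
    ((hB.differentiableAt hn).hasDerivAt.mul (hg'.differentiableAt hn).hasDerivAt)).deriv
  rw [hd]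
  simp only [Pi.add_apply, Pi.mul_apply]
  ring

theorem le_div_pow_of_mul_rpow_le {x C r : ℝ} {k : ℕ} (hx : 0 ≤ x) (hr : 0 ≤ r) (hr1 : r < 1)
    (h : x * (1 - r ^ 2) ^ (k : ℝ) ≤ C) : x ≤ C / (1 - r) ^ k := by
  rw [le_div_iff₀ (pow_pos (sub_pos.2 hr1) k)]
  rw [Real.rpow_natCast] at h
  refine le_trans ?_ h
  have : 1 - r ≤ 1 - r ^ 2 := by nlinarith
  have := sub_pos.2 hr1
  gcongr

theorem mul_rpow_le_of_le_div_pow {x C r : ℝ} {k : ℕ} (hx : 0 ≤ x) (hr : 0 ≤ r) (hr1 : r < 1)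
    (h : x ≤ C / (1 - r) ^ k) : x * (1 - r ^ 2) ^ (k : ℝ) ≤ 2 ^ k * C := by
  have h1 := sub_pos.2 hr1
  rw [le_div_iff₀ (pow_pos h1 k)] at h
  rw [Real.rpow_natCast]
  have h2 : 1 - r ^ 2 ≤ 2 * (1 - r) := by nlinarith [sq_nonneg (1 - r)]
  have h3 : 0 ≤ 1 - r ^ 2 := by nlinarith
  calc x * (1 - r ^ 2) ^ k ≤ x * (2 * (1 - r)) ^ k := by gcongr
    _ = 2 ^ k * (x * (1 - r) ^ k) := by rw [mul_pow]; ring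
    _ ≤ 2 ^ k * C := by gcongr

theorem MemGrowthSpace.exists_le_div {A : ℂ → ℂ} (hA : MemGrowthSpace 2 A) :
    ∃ C : ℝ, ∀ z ∈ unitDisc, ‖A z‖ ≤ C / (1 - ‖z‖) ^ 2 := by
  obtain ⟨-, C, hC⟩ := hA
  exact ⟨C, fun z hz => le_div_pow_of_mul_rpow_le (norm_nonneg _) (norm_nonneg _)
    (mem_unitDisc.1 hz) (by exact_mod_cast hC z hz)⟩

theorem memGrowthSpace_of_le_div {A : ℂ → ℂ} (hA : DifferentiableOn ℂ A unitDisc) {C : ℝ}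
    (hC : ∀ z ∈ unitDisc, ‖A z‖ ≤ C / (1 - ‖z‖) ^ 2) : MemGrowthSpace 2 A :=
  ⟨hA, 2 ^ 2 * C, fun z hz => by
    exact_mod_cast mul_rpow_le_of_le_div_pow (norm_nonneg _) (norm_nonneg _)
      (mem_unitDisc.1 hz) (hC z hz)⟩

theorem MemBloch.exists_le_div {g : ℂ → ℂ} (hg : MemBloch g) :
    ∃ C : ℝ, ∀ z ∈ unitDisc, ‖deriv g z‖ ≤ C / (1 - ‖z‖) ^ 1 := by
  obtain ⟨-, C, hC⟩ := hg
  exact ⟨C, fun z hz => le_div_pow_of_mul_rpow_le (norm_nonneg _) (norm_nonneg _)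
    (mem_unitDisc.1 hz) (by simpa using hC z hz)⟩

theorem memBloch_of_le_div {g : ℂ → ℂ} (hg : DifferentiableOn ℂ g unitDisc) {C : ℝ}
    (hC : ∀ z ∈ unitDisc, ‖deriv g z‖ ≤ C / (1 - ‖z‖) ^ 1) : MemBloch g :=
  ⟨hg, 2 ^ 1 * C, fun z hz => by
    simpa using mul_rpow_le_of_le_div_pow (norm_nonneg _) (norm_nonneg _)
      (mem_unitDisc.1 hz) (hC z hz)⟩

theorem IsBlaschkeProduct.norm_deriv_le {ι : Type*} {a : ι → ℂ} {B : ℂ → ℂ}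
    (hB : IsBlaschkeProduct B a) {z : ℂ} (hz : z ∈ unitDisc) :
    ‖deriv B z‖ ≤ 2 / (1 - ‖z‖) ^ 1 := by
  have := norm_deriv_le_div_pow hB.differentiableOn (C := 1) (k := 0)
    (fun w hw => by simpa using hB.norm_le_one hw) hz
  simpa using this

/-! ### From interpolation to the differential equation -/

/-- The coefficient is `A = -q - g'' - g'²` with `q = (B'' + 2 B' g') / B`; only `q` needs more than
Cauchy estimates. -/
theorem exists_isSolution_mul_exp {ι : Type*} [Countable ι] {a : ι → ℂ}
    (ha : UniformlySeparated a) {B g : ℂ → ℂ} (hB : IsBlaschkeProduct B a) (hg : MemBloch g)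
    (hint : InterpolationProperty B g a) :
    ∃ A : ℂ → ℂ, MemGrowthSpace 2 A ∧ IsSolution A (fun z => B z * Complex.exp (g z)) := by
  obtain ⟨M, -, hM⟩ := ha.exists_sum_one_sub_pseudoHyp_sq_le
  obtain ⟨δ, hδ, -, hsep⟩ := ha.2.1.exists_mul_le_norm_sub hB.norm_lt_one
  have hBd := hB.differentiableOn
  have hBd' := hBd.deriv isOpen_unitDisc
  have hgd : DifferentiableOn ℂ g unitDisc := hg.1
  have hgd' := hgd.deriv isOpen_unitDisc
  set h : ℂ → ℂ := fun z => deriv (deriv B) z + 2 * deriv B z * deriv g z with hh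
  have hhd : DifferentiableOn ℂ h unitDisc :=
    (hBd'.deriv isOpen_unitDisc).add ((hBd'.const_mul 2).mul hgd')
  obtain ⟨q, hq, hBq⟩ := exists_eq_mul_of_simple_zeros hBd hhd fun z hz h0 => by
    obtain ⟨i, rfl⟩ := hB.exists_eq_of_eq_zero ha.2.1 hM hz h0
    have hne := (hB.eq_zero_and_deriv_ne_zero ha.2.1 hM i).2
    refine ⟨hne, ?_⟩
    simp only [hh, hint i]
    field_simp
    ring
  obtain ⟨C, hC⟩ := hg.exists_le_div
  have hB1 : ∀ z ∈ unitDisc, ‖deriv B z‖ ≤ 2 / (1 - ‖z‖) ^ 1 := fun z hz => hB.norm_deriv_le hz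
  have hB2 := fun z hz => norm_deriv_le_div_pow hBd' hB1 (z := z) hz
  have hg2 := fun z hz => norm_deriv_le_div_pow hgd' hC (z := z) hz
  set D : ℝ := 2 ^ (1 + 1) * 2 + 2 * 2 * C
  have hhb : ∀ z ∈ unitDisc, ‖h z‖ ≤ D / (1 - ‖z‖) ^ 2 := fun z hz => by
    have hpos := sub_pos.2 (mem_unitDisc.1 hz)
    calc ‖h z‖ ≤ ‖deriv (deriv B) z‖ + 2 * ‖deriv B z‖ * ‖deriv g z‖ := by
          refine (norm_add_le _ _).trans_eq ?_
          simp
      _ ≤ 2 ^ (1 + 1) * 2 / (1 - ‖z‖) ^ (1 + 1)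
          + 2 * (2 / (1 - ‖z‖) ^ 1) * (C / (1 - ‖z‖) ^ 1) := by
          have := hB1 z hz
          have := hB2 z hz
          have := hC z hz
          gcongr
      _ = _ := by simp only [D]; field_simp; ring
  have hD : 0 ≤ D := by
    have := (norm_nonneg _).trans (hhb 0 (mem_unitDisc.2 (by simp)))
    simpa using this
  obtain ⟨η, hη, hηδ, hη1⟩ : ∃ η : ℝ, 0 < η ∧ η ≤ δ / 2 ∧ η ≤ 1 / 32 :=
    ⟨min (δ / 2) (1 / 32), by positivity, min_le_left _ _, min_le_right _ _⟩
  obtain ⟨c, hc, hcB⟩ := hB.exists_le_norm hM hη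
  -- The lower bound for `|B|` fails near the zeros, so `q` is estimated at a nearby `w` away from
  -- them; `1 - |w| ≥ (1 - |z|)/2` produces the factor `4`.
  have hqb : ∀ z ∈ unitDisc, ‖q z‖ ≤ (4 * D / c) / (1 - ‖z‖) ^ 2 := fun z hz => by
    obtain ⟨w, hw, hwE, hwz, hqw⟩ := exists_norm_le_away hB.norm_lt_one hsep hη hηδ hη1 hq hz
    have hpos := sub_pos.2 (mem_unitDisc.1 hz)
    have h1 := norm_le_norm_add_norm_sub' w z
    have h2 : (1 - ‖z‖) / 2 ≤ 1 - ‖w‖ := by linarith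
    have h3 := hcB w hw hwE
    have h4 := hhb w hw
    rw [hBq w hw, norm_mul] at h4
    calc ‖q z‖ ≤ ‖q w‖ := hqw
      _ ≤ D / (1 - ‖w‖) ^ 2 / c := by
          rw [le_div_iff₀ hc, mul_comm]
          exact (mul_le_mul_of_nonneg_right h3 (norm_nonneg _)).trans h4
      _ ≤ D / ((1 - ‖z‖) / 2) ^ 2 / c := by gcongr
      _ = _ := by field_simp; ring
  refine ⟨fun z => -(q z) - deriv (deriv g) z - deriv g z ^ 2, ?_, ?_, fun z hz => ?_⟩
  · refine memGrowthSpace_of_le_div (C := 4 * D / c + 2 ^ (1 + 1) * C + C ^ 2)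
      ((hq.neg.sub (hgd'.deriv isOpen_unitDisc)).sub (hgd'.pow 2)) fun z hz => ?_
    have hpos := sub_pos.2 (mem_unitDisc.1 hz)
    calc ‖-(q z) - deriv (deriv g) z - deriv g z ^ 2‖
        ≤ ‖q z‖ + ‖deriv (deriv g) z‖ + ‖deriv g z‖ ^ 2 := by
          refine (norm_sub_le _ _).trans ?_
          rw [norm_pow]
          have := norm_sub_le (-(q z)) (deriv (deriv g) z)
          rw [norm_neg] at this
          linarith
      _ ≤ (4 * D / c) / (1 - ‖z‖) ^ 2 + 2 ^ (1 + 1) * C / (1 - ‖z‖) ^ (1 + 1)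
          + (C / (1 - ‖z‖) ^ 1) ^ 2 := by
          have := hqb z hz
          have := hg2 z hz
          have := hC z hz
          gcongr
      _ = _ := by field_simp; ring
  · exact hBd.mul hgd.cexp
  · rw [deriv_deriv_mul_exp hBd hgd hz]
    have := hBq z hz
    simp only [hh] at this
    rw [this]
    ring

/-! ### Growth of solutions and the Bloch bound -/

/-- Take a primitive `g` of `F'/F` with `e^{g(0)} = F(0)`; then `F e^{-g}` has derivative zero. -/
theorem exists_eq_exp {F : ℂ → ℂ} (hF : DifferentiableOn ℂ F unitDisc)
    (h0 : ∀ z ∈ unitDisc, F z ≠ 0) :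
    ∃ g : ℂ → ℂ, DifferentiableOn ℂ g unitDisc ∧ ∀ z ∈ unitDisc, F z = Complex.exp (g z) := by
  have hF' := hF.deriv isOpen_unitDisc
  have hq : DifferentiableOn ℂ (fun z => deriv F z / F z) (Metric.ball 0 1) := hF'.div hF h0
  obtain ⟨g, hg0, hg⟩ := hq.isExactOn_ball.with_val_at 0 (Complex.log (F 0))
  have hgd : DifferentiableOn ℂ g unitDisc :=
    fun z hz => (hg z hz).differentiableAt.differentiableWithinAt
  refine ⟨g, hgd, fun z hz => ?_⟩
  have hz0 : (0 : ℂ) ∈ unitDisc := mem_unitDisc.2 (by simp)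
  have hder : ∀ w ∈ unitDisc, HasDerivAt (fun w => F w * Complex.exp (-g w)) 0 w := fun w hw => by
    have hn := isOpen_unitDisc.mem_nhds hw
    have := (hF.differentiableAt hn).hasDerivAt.mul (hg w hw).neg.cexp
    refine this.congr_deriv ?_
    have := h0 w hw
    simp only [Pi.neg_apply]
    field_simp
    ring
  have hconst := isOpen_unitDisc.is_const_of_deriv_eq_zero
    (convex_ball (0 : ℂ) 1).isPreconnected
    (fun w hw => (hder w hw).differentiableAt.differentiableWithinAt)
    (fun w hw => (hder w hw).deriv) hz hz0
  simp only [hg0, Complex.exp_neg, Complex.exp_log (h0 0 hz0), mul_inv_cancel₀ (h0 0 hz0)] at hconst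
  rwa [← div_eq_mul_inv, div_eq_one_iff_eq (Complex.exp_ne_zero _)] at hconst

/-- Solutions of `f'' + A f = 0` with `A ∈ H^∞_2` grow at a controlled rate in discs
`|w - z| ≤ (1 - |z|) / 2`. -/
theorem IsSolution.norm_le {A f : ℂ → ℂ} (hf : IsSolution A f) {C : ℝ}
    (hA : ∀ z ∈ unitDisc, ‖A z‖ ≤ C / (1 - ‖z‖) ^ 2) {z w : ℂ} (hz : z ∈ unitDisc)
    (hw : ‖w - z‖ ≤ (1 - ‖z‖) / 2) :
    ‖f w‖ ≤ Real.exp (1 + 2 * C) * (‖f z‖ + (1 - ‖z‖) * ‖deriv f z‖) := by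
  have hfd : DifferentiableOn ℂ f unitDisc := hf.1
  have hfd' := hfd.deriv isOpen_unitDisc
  have hC : 0 ≤ C := by
    have := (norm_nonneg _).trans (hA 0 (mem_unitDisc.2 (by simp)))
    simpa using this
  set R := 1 - ‖z‖ with hR
  have hRpos : 0 < R := sub_pos.2 (mem_unitDisc.1 hz)
  set γ : ℝ → ℂ := fun t => z + t * (w - z) with hγ
  have hγd : ∀ t, HasDerivAt γ (w - z) t := fun t => by
    exact ((((hasDerivAt_id t).ofReal_comp).mul_const (w - z)).const_add z).congr_deriv (by simp)
  have hγR : ∀ t ∈ Icc (0 : ℝ) 1, R / 2 ≤ 1 - ‖γ t‖ := fun t ht => by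
    have h1 : ‖γ t‖ ≤ ‖z‖ + t * ‖w - z‖ := by
      refine (norm_add_le _ _).trans_eq ?_
      rw [norm_mul, Complex.norm_real, Real.norm_of_nonneg ht.1]
    nlinarith [ht.1, ht.2, norm_nonneg (w - z)]
  have hγD : ∀ t ∈ Icc (0 : ℝ) 1, γ t ∈ unitDisc := fun t ht =>
    mem_unitDisc.2 (by linarith [hγR t ht])
  -- The weight `R` on `f'` makes the system scale-invariant. Along the segment `|A| ≤ C / (R/2)²`,
  -- so the second component of `v'` is at most `R · (R/2) · C / (R/2)² = 2 C` times `‖v‖`, and the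
  -- Gronwall rate is independent of `z`.
  set v : ℝ → ℂ × ℂ := fun t => (f (γ t), R * deriv f (γ t))
  set v' : ℝ → ℂ × ℂ := fun t =>
    ((w - z) * deriv f (γ t), R * ((w - z) * deriv (deriv f) (γ t)))
  have hv : ∀ t ∈ Icc (0 : ℝ) 1, HasDerivAt v (v' t) t := fun t ht => by
    have hn := isOpen_unitDisc.mem_nhds (hγD t ht)
    have h1 := (hfd.differentiableAt hn).hasDerivAt.scomp t (hγd t)
    have h2 := ((hfd'.differentiableAt hn).hasDerivAt.scomp t (hγd t)).const_mul (R : ℂ)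
    exact h1.prodMk h2
  have hbound : ∀ t ∈ Icc (0 : ℝ) 1, ‖v' t‖ ≤ (1 + 2 * C) * ‖v t‖ + 0 := fun t ht => by
    have hfst : ‖f (γ t)‖ ≤ ‖v t‖ := norm_fst_le (v t)
    have hsnd : R * ‖deriv f (γ t)‖ ≤ ‖v t‖ := by
      refine le_of_eq_of_le ?_ (norm_snd_le (v t))
      simp [v, abs_of_pos hRpos]
    have hvn := norm_nonneg (v t)
    rw [add_zero]
    refine norm_prod_le_iff.2 ⟨?_, ?_⟩
    · simp only [v', norm_mul]
      nlinarith [norm_nonneg (deriv f (γ t))]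
    · have hA' := hA _ (hγD t ht)
      have hR2 := hγR t ht
      have h3 : ‖A (γ t)‖ ≤ C / (R / 2) ^ 2 := hA'.trans (by gcongr)
      have h4 : ‖deriv (deriv f) (γ t)‖ = ‖A (γ t)‖ * ‖f (γ t)‖ := by
        rw [eq_neg_of_add_eq_zero_left (hf.2 _ (hγD t ht)), norm_neg, norm_mul]
      calc ‖(v' t).2‖ = R * (‖w - z‖ * (‖A (γ t)‖ * ‖f (γ t)‖)) := by
            simp [v', abs_of_pos hRpos, h4]
        _ ≤ R * (R / 2 * (C / (R / 2) ^ 2 * ‖v t‖)) := by gcongr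
        _ = 2 * C * ‖v t‖ := by field_simp
        _ ≤ (1 + 2 * C) * ‖v t‖ := by linarith
  have key := norm_le_gronwallBound_of_norm_deriv_right_le (f := v) (f' := v') (a := 0) (b := 1)
    (δ := ‖v 0‖) (fun t ht => (hv t ht).continuousAt.continuousWithinAt)
    (fun t ht => (hv t (Ico_subset_Icc_self ht)).hasDerivWithinAt) le_rfl
    (fun t ht => hbound t (Ico_subset_Icc_self ht)) 1 (right_mem_Icc.2 zero_le_one)
  rw [gronwallBound_ε0, sub_zero, mul_one, mul_comm] at key
  have h1 : ‖f w‖ ≤ ‖v 1‖ := by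
    have h11 : γ 1 = w := by simp [hγ]
    exact h11 ▸ norm_fst_le (v 1)
  have h0 : ‖v 0‖ ≤ ‖f z‖ + R * ‖deriv f z‖ := by
    have h00 : γ 0 = z := by simp [hγ]
    have := norm_nonneg (f z)
    have : 0 ≤ R * ‖deriv f z‖ := by positivity
    refine norm_prod_le_iff.2 ⟨?_, ?_⟩ <;> simp only [v, h00]
    · linarith
    · rw [norm_mul, Complex.norm_real, Real.norm_of_nonneg hRpos.le]; linarith
  exact h1.trans (key.trans (by gcongr))

/-- The derivative at the centre of a disc of an analytic function with real part bounded above. -/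
theorem norm_deriv_le_of_re_sub_le {g : ℂ → ℂ} {z : ℂ} {r M : ℝ} (hr : 0 < r) (hM : 0 < M)
    (hg : DifferentiableOn ℂ g (Metric.ball z r))
    (h : ∀ w ∈ Metric.ball z r, (g w).re - (g z).re ≤ M) : ‖deriv g z‖ ≤ 4 * M / r := by
  set φ : ℂ → ℂ := fun u => g (z + u) - g z
  have hmap : MapsTo (fun u => z + u) (Metric.ball 0 r) (Metric.ball z r) := fun u hu => by
    simpa using hu
  have hφ : DifferentiableOn ℂ φ (Metric.ball 0 r) :=
    (hg.comp (by fun_prop) hmap).sub_const _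
  -- Borel–Carathéodory at half the radius gives `2 M`; Cauchy's estimate there gives `2 M / (r/2)`.
  have hb : ∀ u ∈ Metric.sphere (0 : ℂ) (r / 2), ‖φ u‖ ≤ 2 * M := fun u hu => by
    have hu' : ‖u‖ = r / 2 := by simpa using hu
    have := Complex.borelCaratheodory_zero hM hφ
      (fun u hu => by simpa [φ] using h _ (hmap hu)) hr (z := u)
      (by simp [hu']; linarith) (by simp [φ])
    rw [hu'] at this
    refine this.trans_eq ?_
    field_simp
    ring
  have hd := Complex.norm_deriv_le_of_forall_mem_sphere_norm_le (half_pos hr)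
    (hφ.diffContOnCl_ball (Metric.closedBall_subset_ball (half_lt_self hr))) hb
  have e : deriv φ 0 = deriv g z := by
    simp only [φ, deriv_sub_const]
    rw [deriv_comp_const_add, add_zero]
  rw [e] at hd
  refine hd.trans_eq ?_
  field_simp
  ring

theorem memBloch_of_isSolution_mul_exp {ι : Type*} [Countable ι] {a : ι → ℂ}
    (ha : UniformlySeparated a) {A f B g : ℂ → ℂ} (hA : MemGrowthSpace 2 A) (hf : IsSolution A f)
    (hB : IsBlaschkeProduct B a) (hg : DifferentiableOn ℂ g unitDisc)
    (hfB : ∀ z ∈ unitDisc, f z = B z * Complex.exp (g z)) : MemBloch g := by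
  obtain ⟨M, -, hM⟩ := ha.exists_sum_one_sub_pseudoHyp_sq_le
  obtain ⟨δ, hδ, -, hsep⟩ := ha.2.1.exists_mul_le_norm_sub hB.norm_lt_one
  obtain ⟨η, hη, hηδ, hη1⟩ : ∃ η : ℝ, 0 < η ∧ η ≤ δ / 2 ∧ η ≤ 1 / 32 :=
    ⟨min (δ / 2) (1 / 32), by positivity, min_le_left _ _, min_le_right _ _⟩
  obtain ⟨c, hc, hcB⟩ := hB.exists_le_norm hM hη
  obtain ⟨C, hC⟩ := hA.exists_le_div
  have hC0 : 0 ≤ C := by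
    have := (norm_nonneg _).trans (hC 0 (mem_unitDisc.2 (by simp)))
    simpa using this
  set K : ℝ := Real.exp (1 + 2 * C) / c
  -- The maximum with `1` makes `log (K' (3 + N))` positive, as Borel–Carathéodory requires.
  set K' : ℝ := max K 1
  have hK' : 1 ≤ K' := le_max_right _ _
  refine memBloch_of_le_div hg (C := 2 * (16 * Real.log (64 * K') + 1)) fun z hz => ?_
  have hz1 := mem_unitDisc.1 hz
  set R := 1 - ‖z‖ with hR
  have hRpos : 0 < R := sub_pos.2 hz1
  set N := R * ‖deriv g z‖ with hN
  have hN0 : 0 ≤ N := by positivity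
  have hexp : ∀ w, ‖Complex.exp (g w)‖ = Real.exp (g w).re := fun w => Complex.norm_exp _
  have hf1 : ‖f z‖ ≤ Real.exp (g z).re := by
    rw [hfB z hz, norm_mul, hexp]
    exact mul_le_of_le_one_left (Real.exp_pos _).le (hB.norm_le_one hz)
  have hf2 : R * ‖deriv f z‖ ≤ (2 + N) * Real.exp (g z).re := by
    have e : deriv f z = (deriv B z + B z * deriv g z) * Complex.exp (g z) := by
      rw [← deriv_mul_exp hB.differentiableOn hg hz]
      exact (eventuallyEq_of_mem (isOpen_unitDisc.mem_nhds hz) hfB).deriv_eq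
    rw [e, norm_mul, hexp, ← mul_assoc]
    refine mul_le_mul_of_nonneg_right ?_ (Real.exp_pos _).le
    have h1 := hB.norm_deriv_le hz
    rw [pow_one, le_div_iff₀ hRpos] at h1
    have h2 := hB.norm_le_one hz
    have h3 := norm_add_le (deriv B z) (B z * deriv g z)
    rw [norm_mul] at h3
    have h4 : ‖B z‖ * ‖deriv g z‖ ≤ ‖deriv g z‖ := mul_le_of_le_one_left (norm_nonneg _) h2
    nlinarith
  have hball : Metric.ball z (R / 4) ⊆ unitDisc := fun w hw => by
    rw [mem_ball_iff_norm] at hw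
    have := norm_le_norm_add_norm_sub' w z
    exact mem_unitDisc.2 (by linarith)
  have hre : ∀ ζ ∈ Metric.ball z (R / 4),
      (g ζ).re - (g z).re ≤ Real.log (K' * (3 + N)) := fun ζ hζ => by
    -- Applied to `e^g`, this moves `ζ` to a point where `|B| ≥ c`, still within `R/2` of `z`, so
    -- that `|e^g| ≤ |f| / c` there.
    obtain ⟨w, hw, hwE, hwζ, hFw⟩ :=
      exists_norm_le_away hB.norm_lt_one hsep hη hηδ hη1 hg.cexp (hball hζ)
    rw [mem_ball_iff_norm] at hζ
    have h1 := norm_sub_le_norm_sub_add_norm_sub w ζ z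
    have h2 := norm_le_norm_add_norm_sub ζ z
    have h3 : ‖w - z‖ ≤ R / 2 := by linarith
    have h4 := hf.norm_le hC hz h3
    have h5 : c * ‖Complex.exp (g w)‖ ≤ ‖f w‖ := by
      rw [hfB w hw, norm_mul]
      exact mul_le_mul_of_nonneg_right (hcB w hw hwE) (norm_nonneg _)
    rw [Real.le_log_iff_exp_le (by positivity), Real.exp_sub, div_le_iff₀ (Real.exp_pos _)]
    calc Real.exp (g ζ).re = ‖Complex.exp (g ζ)‖ := (hexp ζ).symm
      _ ≤ ‖Complex.exp (g w)‖ := hFw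
      _ ≤ Real.exp (1 + 2 * C) * (‖f z‖ + R * ‖deriv f z‖) / c := by
          rw [le_div_iff₀ hc, mul_comm]
          exact h5.trans h4
      _ = K * (‖f z‖ + R * ‖deriv f z‖) := by simp only [K]; ring
      _ ≤ K' * (Real.exp (g z).re + (2 + N) * Real.exp (g z).re) := by
          have : K ≤ K' := le_max_left _ _
          gcongr
      _ = _ := by ring
  have hlogpos : 0 < Real.log (K' * (3 + N)) := Real.log_pos (by nlinarith)
  have hd := norm_deriv_le_of_re_sub_le (by positivity) hlogpos (hg.mono hball) hre
  -- The scale `64` leaves only `16 · N/64 = N/4` on the right of `N ≤ 16 log (K' (3 + N))`, which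
  -- is absorbed by the left side.
  have hlog : Real.log (K' * (3 + N)) ≤ Real.log (64 * K') + ((3 + N) / 64 - 1) := by
    have : K' * (3 + N) = 64 * K' * ((3 + N) / 64) := by ring
    rw [this, Real.log_mul (by positivity) (by positivity)]
    gcongr
    exact Real.log_le_sub_one_of_pos (by positivity)
  have hNle : N ≤ 16 * Real.log (K' * (3 + N)) := by
    rw [le_div_iff₀ (by positivity)] at hd
    nlinarith
  have hlog0 : 0 ≤ Real.log (64 * K') := Real.log_nonneg (by linarith)
  rw [pow_one, le_div_iff₀ hRpos, mul_comm]
  linarith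

/-! ### Factorization of solutions -/

theorem IsSeparated.injective {ι : Type*} {a : ι → ℂ} (h : IsSeparated a) :
    Function.Injective a := by
  obtain ⟨δ, h0, -, h⟩ := h
  intro i j hij
  by_contra hne
  have := h i j hne
  rw [hij, pseudoHyp, sub_self, norm_zero, zero_div] at this
  linarith

theorem exists_eq_blaschke_mul_exp {ι : Type*} [Countable ι] {a : ι → ℂ}
    (ha : UniformlySeparated a) {A f : ℂ → ℂ} (hA : MemGrowthSpace 2 A) (hf : IsSolution A f)
    (hfa : IsZeroSequence f a) :
    ∃ B g : ℂ → ℂ, IsBlaschkeProduct B a ∧ MemBloch g ∧ InterpolationProperty B g a ∧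
      ∀ z ∈ unitDisc, f z = B z * Complex.exp (g z) := by
  obtain ⟨M, -, hM⟩ := ha.exists_sum_one_sub_pseudoHyp_sq_le
  have ha1 : ∀ i, ‖a i‖ < 1 := fun i => mem_unitDisc.1 (ha.1 i)
  have hB := isBlaschkeProduct_blaschkeProd ha1
    (summable_one_sub_norm ha1 (hM 0 (mem_unitDisc.2 (by simp))))
  set B := blaschkeProd a
  have hBd := hB.differentiableOn
  have hfd : DifferentiableOn ℂ f unitDisc := hf.1
  have hfan : ∀ z ∈ unitDisc, AnalyticAt ℂ f z := fun z hz =>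
    hfd.analyticAt (isOpen_unitDisc.mem_nhds hz)
  have hB0 := fun i => hB.eq_zero_and_deriv_ne_zero ha.2.1 hM i
  have horder : ∀ i, analyticOrderAt f (a i) = 1 := fun i => by
    rw [hfa.2 _ (ha.1 i)]
    have : {j | a j = a i} = {i} := by
      ext j
      simp [ha.2.1.injective.eq_iff]
    rw [this, Set.encard_singleton]
  have hf0 : ∀ i, f (a i) = 0 := fun i => by
    by_contra hne
    have := (hfan _ (ha.1 i)).analyticOrderAt_eq_zero.2 hne
    rw [horder i] at this
    exact one_ne_zero this
  obtain ⟨F, hF, hBF⟩ := exists_eq_mul_of_simple_zeros hBd hfd fun z hz h0 => by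
    obtain ⟨i, rfl⟩ := hB.exists_eq_of_eq_zero ha.2.1 hM hz h0
    exact ⟨(hB0 i).2, hf0 i⟩
  -- Separated points are distinct, so `f` has only simple zeros; a zero of `F` at some `a_i` would
  -- make `f'` vanish there as well.
  have hF0 : ∀ z ∈ unitDisc, F z ≠ 0 := fun z hz h0 => by
    have hfz : f z = 0 := by rw [hBF z hz, h0, mul_zero]
    by_cases hz' : ∃ i, a i = z
    · obtain ⟨i, rfl⟩ := hz'
      have h1 := (hfan _ hz).analyticOrderAt_deriv_add_one
      simp only [hfz, sub_zero] at h1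
      rw [horder i] at h1
      have h2 : analyticOrderAt (deriv f) (a i) = 0 := by simpa using h1
      refine (hfan _ hz).deriv.analyticOrderAt_eq_zero.1 h2 ?_
      have hn := isOpen_unitDisc.mem_nhds hz
      rw [(eventuallyEq_of_mem hn hBF).deriv_eq]
      have := ((hBd.differentiableAt hn).hasDerivAt.mul (hF.differentiableAt hn).hasDerivAt).deriv
      refine this.trans ?_
      rw [h0, (hB0 i).1]
      ring
    · have : analyticOrderAt f z = 0 := by
        rw [hfa.2 z hz, Set.encard_eq_zero]
        ext i
        simpa using fun h => hz' ⟨i, h⟩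
      exact (hfan _ hz).analyticOrderAt_eq_zero.1 this hfz
  obtain ⟨g, hg, hFg⟩ := exists_eq_exp hF hF0
  have hfB : ∀ z ∈ unitDisc, f z = B z * Complex.exp (g z) := fun z hz => by
    rw [hBF z hz, hFg z hz]
  refine ⟨B, g, hB, memBloch_of_isSolution_mul_exp ha hA hf hB hg hfB, fun i => ?_, hfB⟩
  have hn := isOpen_unitDisc.mem_nhds (ha.1 i)
  have h1 := hf.2 _ (ha.1 i)
  have e : f =ᶠ[𝓝 (a i)] fun z => B z * Complex.exp (g z) := eventuallyEq_of_mem hn hfB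
  -- At `a_i` the equation reduces to `f'' = 0`, that is `B'' + 2 B' g' = 0`.
  rw [hf0 i, mul_zero, add_zero, e.deriv.deriv_eq, deriv_deriv_mul_exp hBd hg (ha.1 i),
    (hB0 i).1, zero_mul, add_zero] at h1
  have h2 := (mul_eq_zero.1 h1).resolve_right (Complex.exp_ne_zero _)
  have := (hB0 i).2
  field_simp
  linear_combination h2

end DiscODE

theorem theorem2 {ι : Type*} [Countable ι] (a : ι → ℂ) (ha : UniformlySeparated a) :
    (∀ A f : ℂ → ℂ, MemGrowthSpace 2 A → IsSolution A f → IsZeroSequence f a →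
      ∃ B g : ℂ → ℂ, IsBlaschkeProduct B a ∧ MemBloch g ∧ InterpolationProperty B g a ∧
        ∀ z ∈ unitDisc, f z = B z * Complex.exp (g z)) ∧
    (∀ B g : ℂ → ℂ, IsBlaschkeProduct B a → MemBloch g → InterpolationProperty B g a →
      ∃ A : ℂ → ℂ, MemGrowthSpace 2 A ∧ IsSolution A (fun z => B z * Complex.exp (g z))) :=
  ⟨fun _ _ hA hf hfa => exists_eq_blaschke_mul_exp ha hA hf hfa,
    fun _ _ hB hg hint => exists_isSolution_mul_exp ha hB hg hint⟩
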